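/- Let $\mathcal{L}$ be an algebraic signature with at least one constant symbol and let $\mathcal{V}$ be a variety of $\mathcal{L}$-algebras, that is, the class of all $\mathcal{L}$-algebras satisfying some fixed set of equations. Equations are pairs $\alpha\approx\beta$ of $\mathcal{L}$-terms; $\overline{x},\overline{y},\overline{z}$ denote pairwise disjoint sets of variables, and $\Sigma(\overline{x},\overline{y})$ means that all variables of $\Sigma$ are among $\overline{x},\overline{y}$. For sets of equations $\Sigma,\Delta$, write $\Sigma\models_{\mathcal{V}}\Delta$ if every assignment of the variables in any algebra of $\mathcal{V}$ that satisfies all equations of $\Sigma$ satisfies all equations of $\Delta$. For an algebra $\mathbf{A}$, let $\mathrm{Con}\,\mathbf{A}$ be its congruence lattice, ordered by inclusion, and $\mathrm{KCon}\,\mathbf{A}$ the subposet of its compact (i.e., finitely generated) congruences. The compact lifting of a homomorphism $h\colon\mathbf{A}\to\mathbf{B}$ is the map $\mathrm{KCon}\,\mathbf{A}\to\mathrm{KCon}\,\mathbf{B}$ sending $\psi$ to the congruence of $\mathbf{B}$ generated by $\{(h(a),h(a')) : (a,a')\in\psi\}$. It has a right adjoint if there is a map $g\colon\mathrm{KCon}\,\mathbf{B}\to\mathrm{KCon}\,\mathbf{A}$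 such that for all $\psi\in\mathrm{KCon}\,\mathbf{A}$ and $\theta\in\mathrm{KCon}\,\mathbf{B}$, the compact lifting of $h$ sends $\psi$ below $\theta$ if and only if $\psi\le g(\theta)$. An algebra $\mathbf{A}$ of $\mathcal{V}$ is finitely presented if there is a surjective homomorphism onto $\mathbf{A}$ with compact kernel from the $\mathcal{V}$-free algebra $\mathbf{F}(\overline{x})$ on some finite set $\overline{x}$. The following are equivalent: (i) $\mathcal{V}$ admits right uniform Maehara interpolation: for any finite sets $\overline{x},\overline{y}$ and any finite set of equations $\Gamma(\overline{x},\overline{y})$, there exists a finite set of equations $\Pi(\overline{y})$ such that for any finite sets of equations $\Sigma(\overline{y},\overline{z}),\Delta(\overline{y},\overline{z})$, $$\Gamma,\Sigma\models_{\mathcal{V}}\Delta\iff\Pi,\Sigma\models_{\mathcal{V}}\Delta.$$ (ii) $\mathcal{V}$ admits right uniform deductive interpolation: for any finite sets $\overline{x},\overline{y}$ and any finite set of equations $\Sigma(\overline{x},\overline{y})$, there exists a finite set of equations $\Pi(\overline{y})$ such that $\Sigma\models_{\mathcal{V}}\Pi$ and, for any equation $\varepsilon(\overline{y},\overline{z})$,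 $\Sigma\models_{\mathcal{V}}\varepsilon$ implies $\Pi\models_{\mathcal{V}}\varepsilon$; and $\mathcal{V}$ has the congruence extension property: every congruence of a subalgebra of an algebra $\mathbf{A}\in\mathcal{V}$ is the restriction of a congruence of $\mathbf{A}$. (iii) $\mathcal{V}$ has the amalgamation property (for all $\mathbf{A},\mathbf{B},\mathbf{C}\in\mathcal{V}$ and embeddings $i\colon\mathbf{A}\to\mathbf{B}$, $j\colon\mathbf{A}\to\mathbf{C}$ there are $\mathbf{D}\in\mathcal{V}$ and embeddings $h\colon\mathbf{B}\to\mathbf{D}$, $k\colon\mathbf{C}\to\mathbf{D}$ with $hi=kj$) and the congruence extension property, and the compact lifting of any homomorphism between finitely presented algebras in $\mathcal{V}$ has a right adjoint. -/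

import Mathlib

open FirstOrder

universe u v w

namespace UnivAlg

/-! An algebraic signature is a first-order language `L` without relation symbols
(`L.IsAlgebraic`), an `L`-algebra is an `L`-structure, homomorphisms are `A →[L] B`, embeddings
are `A ↪[L] B`, and subalgebras are `L.Substructure A`. -/

/-! ### Congruences -/

section Congruences

/-- A congruence on an `L`-algebra: an equivalence relation compatible with all operations. -/
@[ext]
structure Congruence (L : FirstOrder.Language.{u, v}) (A : Type w) [L.Structure A] where
  rel : Setoid A
  compat : ∀ {n : ℕ} (f : L.Functions n) (x y : Fin n → A), (∀ i, rel.r (x i) (y i)) →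
    rel.r (FirstOrder.Language.Structure.funMap f x) (FirstOrder.Language.Structure.funMap f y)

namespace Congruence

variable {L : FirstOrder.Language.{u, v}} {A B : Type*} [L.Structure A] [L.Structure B]

/-- Congruences are ordered by inclusion. -/
instance : PartialOrder (Congruence L A) where
  le θ ψ := ∀ a b : A, θ.rel.r a b → ψ.rel.r a b
  le_refl _ _ _ h := h
  le_trans _ _ _ h₁ h₂ a b h := h₂ a b (h₁ a b h)
  le_antisymm θ ψ h₁ h₂ := Congruence.ext (Setoid.ext fun a b => ⟨h₁ a b, h₂ a b⟩)

/-- The infimum of a set of congruences is their intersection. -/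
instance : InfSet (Congruence L A) where
  sInf S :=
    { rel :=
        { r := fun a b => ∀ θ ∈ S, θ.rel.r a b
          iseqv :=
            ⟨fun a θ _ => θ.rel.refl a, fun h θ hθ => θ.rel.symm (h θ hθ),
              fun h₁ h₂ θ hθ => θ.rel.trans (h₁ θ hθ) (h₂ θ hθ)⟩ }
      compat := fun f x y h θ hθ => θ.compat f x y fun i => h i θ hθ }

instance : CompleteLattice (Congruence L A) :=
  completeLatticeOfInf (Congruence L A) fun _ =>
    ⟨fun _ hθ _ _ h => h _ hθ, fun _ hψ a b h θ hθ => hψ hθ a b h⟩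

/-- The congruence generated by a set of pairs. -/
def gen (L : FirstOrder.Language.{u, v}) {A : Type*} [L.Structure A] (S : Set (A × A)) : Congruence L A :=
  sInf {θ | ∀ p ∈ S, θ.rel.r p.1 p.2}

/-- The inverse image `h⁻¹(θ)` of a congruence under a homomorphism. -/
def comap (h : A →[L] B) (θ : Congruence L B) : Congruence L A where
  rel :=
    { r := fun a a' => θ.rel.r (h a) (h a')
      iseqv :=
        ⟨fun a => θ.rel.refl (h a), fun h' => θ.rel.symm h', fun h₁ h₂ => θ.rel.trans h₁ h₂⟩ }
  compat f x y hxy := by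
    change θ.rel.r (h _) (h _)
    rw [h.map_fun, h.map_fun]
    exact θ.compat f _ _ hxy

/-- The direct image `h^*(ψ)` of a congruence under a homomorphism: the congruence generated by
the pairs `(h a, h a')` with `(a, a') ∈ ψ`. -/
def map (h : A →[L] B) (ψ : Congruence L A) : Congruence L B :=
  gen L {p | ∃ a a' : A, ψ.rel.r a a' ∧ p = (h a, h a')}

/-- The kernel of a homomorphism. -/
def ker (h : A →[L] B) : Congruence L A where
  rel :=
    { r := fun a a' => h a = h a'
      iseqv := ⟨fun _ => rfl, fun h' => h'.symm, fun h₁ h₂ => h₁.trans h₂⟩ }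
  compat f x y hxy := by
    change h _ = h _
    rw [h.map_fun, h.map_fun]
    exact congrArg _ (funext hxy)

theorem gc_map_comap (h : A →[L] B) : GaloisConnection (map h) (comap h) := by
  intro ψ θ
  constructor
  · intro hle a a' haa'
    refine hle (h a) (h a') fun χ hχ => ?_
    exact hχ (h a, h a') ⟨a, a', haa', rfl⟩
  · intro hle b b' hbb'
    refine hbb' θ ?_
    rintro _ ⟨a, a', haa', rfl⟩
    exact hle a a' haa'

/-- The union of a nonempty directed set of congruences. -/
def directedUnion (S : Set (Congruence L A)) (hne : S.Nonempty) (hdir : DirectedOn (· ≤ ·) S) :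
    Congruence L A where
  rel :=
    { r := fun a b => ∃ θ ∈ S, θ.rel.r a b
      iseqv :=
        ⟨fun a => ⟨hne.some, hne.some_mem, hne.some.rel.refl a⟩,
          fun ⟨θ, hθ, h⟩ => ⟨θ, hθ, θ.rel.symm h⟩,
          fun ⟨θ₁, hθ₁, h₁⟩ ⟨θ₂, hθ₂, h₂⟩ =>
            let ⟨θ, hθ, hl₁, hl₂⟩ := hdir θ₁ hθ₁ θ₂ hθ₂
            ⟨θ, hθ, θ.rel.trans (hl₁ _ _ h₁) (hl₂ _ _ h₂)⟩⟩ }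
  compat {n} f x y h := by
    choose g hg hgr using h
    have hne' : Nonempty S := hne.to_subtype
    have hd : Directed (· ≤ ·) (fun s : S => (s : Congruence L A)) := hdir.directed_val
    obtain ⟨⟨θ, hθ⟩, hle⟩ := hd.finite_le (fun i => (⟨g i, hg i⟩ : S))
    exact ⟨θ, hθ, θ.compat f x y fun i => hle i _ _ (hgr i)⟩

/-- The direct image of a compact congruence is compact. -/
theorem isCompactElement_map (h : A →[L] B) {ψ : Congruence L A} (hψ : IsCompactElement ψ) :
    IsCompactElement (map h ψ) := by
  intro S χ hne hdir hlub hle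
  have hχ : χ ≤ directedUnion S hne hdir := hlub.2 fun θ hθ a b hab => ⟨θ, hθ, hab⟩
  have hle' : ψ ≤ comap h (directedUnion S hne hdir) := (gc_map_comap h).le_u (hle.trans hχ)
  obtain ⟨_, ⟨θ, hθ, rfl⟩, hψθ⟩ := hψ (comap h '' S) (comap h (directedUnion S hne hdir))
    (hne.image _)
    (by
      rintro _ ⟨θ₁, hθ₁, rfl⟩ _ ⟨θ₂, hθ₂, rfl⟩
      obtain ⟨θ, hθ, hl₁, hl₂⟩ := hdir θ₁ hθ₁ θ₂ hθ₂
      exact ⟨_, ⟨θ, hθ, rfl⟩, (gc_map_comap h).monotone_u hl₁, (gc_map_comap h).monotone_u hl₂⟩)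
    ⟨by
      rintro _ ⟨θ, hθ, rfl⟩ a b hab
      exact ⟨θ, hθ, hab⟩,
     by
      rintro ρ hρ a b ⟨θ, hθ, hab⟩
      exact hρ ⟨θ, hθ, rfl⟩ a b hab⟩
    hle'
  exact ⟨θ, hθ, (gc_map_comap h).l_le hψθ⟩

end Congruence

/-- The poset (indeed join-semilattice) of compact congruences of `A`, ordered by inclusion. -/
abbrev KCon (L : FirstOrder.Language.{u, v}) (A : Type w) [L.Structure A] : Type w :=
  {θ : Congruence L A // IsCompactElement θ}

/-- The compact lifting of a homomorphism `h`: the restriction of `h^*` to compact congruences. -/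
def compactLifting {L : FirstOrder.Language.{u, v}} {A B : Type*} [L.Structure A] [L.Structure B]
    (h : A →[L] B) (θ : KCon L A) : KCon L B :=
  ⟨Congruence.map h θ.1, Congruence.isCompactElement_map h θ.2⟩

end Congruences

/-! ### Term algebras and quotients -/

/-- The term algebra over a set `X` of variables. -/
instance termStructure (L : FirstOrder.Language.{u, v}) [L.IsAlgebraic] (X : Type w) :
    L.Structure (L.Term X) where
  funMap f ts := FirstOrder.Language.Term.func f ts
  RelMap r _ := isEmptyElim r

/-- The operations of an algebra are compatible with a congruence; Mathlib then provides the
quotient algebra structure on `Quotient θ.rel`. -/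
instance Congruence.prestructure {L : FirstOrder.Language.{u, v}} [L.IsAlgebraic] {A : Type w}
    [L.Structure A] (θ : Congruence L A) : L.Prestructure θ.rel where
  toStructure := inferInstance
  fun_equiv {_} {f} x y h := θ.compat f x y h
  rel_equiv {_} {r} _ _ _ := isEmptyElim r

/-! ### Equations, varieties and equational consequence -/

/-- An equation `α ≈ β` over a set `X` of variables is an ordered pair of terms. -/
abbrev Equation (L : FirstOrder.Language.{u, v}) (X : Type w) := L.Term X × L.Term X

/-- Renaming of variables in an equation. It is only used below along injections, to regard an
equation over a set of variables as an equation over a larger set. -/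
def Equation.rename {L : FirstOrder.Language.{u, v}} {X Y : Type*} (f : X → Y) (e : Equation L X) :
    Equation L Y :=
  (e.1.relabel f, e.2.relabel f)

/-- The equation `e` holds in `A` under the assignment `a`. -/
def Equation.Holds {L : FirstOrder.Language.{u, v}} {X A : Type*} [L.Structure A] (a : X → A)
    (e : Equation L X) : Prop :=
  e.1.realize a = e.2.realize a

/-- A variety is the class of all algebras satisfying a given set of equations; each equation
contains finitely many variables, which are taken from a fixed countably infinite set. -/
structure Variety (L : FirstOrder.Language.{u, v}) where
  identities : Set (Equation L ℕ)

namespace Variety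

variable {L : FirstOrder.Language.{u, v}}

/-- The algebra `A` belongs to the variety `V`. -/
def Mem (V : Variety L) (A : Type w) [L.Structure A] : Prop :=
  ∀ e ∈ V.identities, ∀ a : ℕ → A, e.Holds a

/-- `S ⊨_V e`. -/
def Entails (V : Variety L) {X : Type w} (S : Set (Equation L X)) (e : Equation L X) : Prop :=
  ∀ (A : Type u) [L.Structure A], V.Mem A → ∀ a : X → A, (∀ s ∈ S, s.Holds a) → e.Holds a

/-- `S ⊨_V D` for a set of equations `D`. -/
def EntailsSet (V : Variety L) {X : Type w} (S D : Set (Equation L X)) : Prop :=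
  ∀ e ∈ D, V.Entails S e

/-- The congruence of the term algebra `T(X)` whose quotient is the largest one that lies
in `V`. -/
def freeCongruence [L.IsAlgebraic] (V : Variety L) (X : Type w) : Congruence L (L.Term X) :=
  sInf {θ | V.Mem (Quotient θ.rel)}

/-- The `V`-free algebra `F(X)` on the set `X` of free generators, constructed as the largest
quotient of the term algebra `T(X)` that lies in `V`. -/
abbrev Free [L.IsAlgebraic] (V : Variety L) (X : Type w) : Type (max u w) :=
  Quotient (V.freeCongruence X).rel

/-- `A` is a finitely presented algebra of `V`: there are a finite set `X` and a surjective
homomorphism `F(X) → A` whose kernel is compact. -/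
def IsFinitelyPresented [L.IsAlgebraic] (V : Variety L) (A : Type u) [L.Structure A] : Prop :=
  V.Mem A ∧ ∃ (X : Type) (_ : Finite X) (p : V.Free X →[L] A),
    Function.Surjective p ∧ IsCompactElement (Congruence.ker p)

/-- Amalgamation property. -/
def AmalgamationProperty (V : Variety L) : Prop :=
  ∀ (A B C : Type u) [L.Structure A] [L.Structure B] [L.Structure C],
    V.Mem A → V.Mem B → V.Mem C → ∀ (i : A ↪[L] B) (j : A ↪[L] C),
      ∃ (D : Type u) (_ : L.Structure D), V.Mem D ∧
        ∃ (h : B ↪[L] D) (k : C ↪[L] D), ∀ a : A, h (i a) = k (j a)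

/-- Congruence extension property: every congruence of a subalgebra `S` of an algebra `A` of `V`
is the restriction to `S` of a congruence of `A`. -/
def CongruenceExtensionProperty (V : Variety L) : Prop :=
  ∀ (A : Type u) [L.Structure A], V.Mem A → ∀ (S : L.Substructure A) (θ : Congruence L S),
    ∃ ψ : Congruence L A, ∀ a b : S, ψ.rel.r (a : A) (b : A) ↔ θ.rel.r a b

/-- The compact lifting of any homomorphism between finitely presented algebras of `V` has a
right adjoint. -/
def CompactLiftingsHaveRightAdjoints [L.IsAlgebraic] (V : Variety L) : Prop :=
  ∀ (A B : Type u) [L.Structure A] [L.Structure B],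
    V.IsFinitelyPresented A → V.IsFinitelyPresented B → ∀ h : A →[L] B,
      ∃ g : KCon L B → KCon L A, GaloisConnection (compactLifting h) g

/-- Right uniform deductive interpolation. Disjoint unions of sets of variables are sum types:
`X ⊕ Y` stands for `x̄, ȳ` and `X ⊕ (Y ⊕ Z)` for `x̄, ȳ, z̄`. -/
def RightUniformDeductiveInterpolation (V : Variety L) : Prop :=
  ∀ (X Y : Type) [Finite X] [Finite Y] (S : Set (Equation L (X ⊕ Y))), S.Finite →
    ∃ P : Set (Equation L Y), P.Finite ∧
      V.EntailsSet S (Equation.rename Sum.inr '' P) ∧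
      ∀ (Z : Type) (e : Equation L (Y ⊕ Z)),
        V.Entails (Equation.rename (Sum.map id Sum.inl) '' S :
            Set (Equation L (X ⊕ (Y ⊕ Z)))) (e.rename Sum.inr) →
          V.Entails (Equation.rename Sum.inl '' P) e

/-- Right uniform Maehara interpolation, with the same conventions on variables. -/
def RightUniformMaeharaInterpolation (V : Variety L) : Prop :=
  ∀ (X Y : Type) [Finite X] [Finite Y] (G : Set (Equation L (X ⊕ Y))), G.Finite →
    ∃ P : Set (Equation L Y), P.Finite ∧
      ∀ (Z : Type) (S D : Set (Equation L (Y ⊕ Z))), S.Finite → D.Finite →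
        (V.EntailsSet
            (Equation.rename (Sum.map id Sum.inl) '' G ∪ Equation.rename Sum.inr '' S :
              Set (Equation L (X ⊕ (Y ⊕ Z))))
            (Equation.rename Sum.inr '' D) ↔
          V.EntailsSet (Equation.rename Sum.inl '' P ∪ S) D)

end Variety

end UnivAlg

/-!
The three conditions are linked through two facts about a variety `V`.

*Transferable injections.* Maehara interpolation says that an injective homomorphism `i : A → B`
can be pushed out along any `f : A → C` in such a way that `C` embeds into the pushout
(`exists_transfer`). The pushout is presented by the equational diagrams of `B` and `C` and the
identifications `i a ≈ f a`. If it identified two elements of `C`, finitely many of these equations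
would be responsible; an interpolant for those concerning `B`, over variables naming elements of
`A`, is true in `B`, hence in `A`, hence in `C`, and forces the two elements to be equal already in
`C` (`eq_of_entails`). Taking both transfers into a product gives amalgamation, and transferring a
subalgebra inclusion along a quotient map gives congruence extension. Conversely, a uniform
deductive interpolant `P(y)` of `G(x, y)` says that the algebra presented by `P` over `y, z` embeds
into the one presented by `G` over `x, y, z`; under congruence extension, the congruence generated
by side equations `S(y, z)` on the former is the restriction of one on the latter, so that `P` is
also a Maehara interpolant (`CongruenceExtensionProperty.entails_union`).

*Adjoints.* The compact lifting of `h` is the restriction of a map with right adjoint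
`Congruence.comap h`, so it has a right adjoint as soon as `comap h` preserves compactness. For `h`
between finitely presented algebras, `comap h θ` is generated by a deductive interpolant of a finite
presentation of `B / θ` together with terms describing `h` on the generators of `A`
(`isCompactElement_comap`). Conversely, the right adjoint for the inclusion of free algebras
`F(y) → F(x, y)` provides an interpolant for equations in `y` alone; amalgamation over the algebra it
presents extends this to equations in `y, z`
(`rightUniformDeductiveInterpolation_of_amalgamation`).
-/

namespace UnivAlg

/-! ### Homomorphisms and quotients -/

section Homomorphisms

variable {L : FirstOrder.Language.{u, v}} {A B C : Type*} [L.Structure A] [L.Structure B]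
  [L.Structure C]

/-- In a signature without relation symbols, a map that commutes with the operations is a
homomorphism. -/
def homOfMapFun [L.IsAlgebraic] (f : A → B)
    (hf : ∀ {n : ℕ} (g : L.Functions n) (x : Fin n → A),
      f (Language.Structure.funMap g x) = Language.Structure.funMap g (f ∘ x)) : A →[L] B where
  toFun := f
  map_fun' := hf
  map_rel' r _ := isEmptyElim r

theorem exists_hom_comp_eq_of_ker_le [L.IsAlgebraic] (q : A →[L] B) (hq : Function.Surjective q)
    (φ : A →[L] C) (h : Congruence.ker q ≤ Congruence.ker φ) :
    ∃ ψ : B →[L] C, ∀ a, ψ (q a) = φ a := by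
  have key : ∀ a, φ (Function.surjInv hq (q a)) = φ a := fun a =>
    h _ _ (Function.surjInv_eq hq (q a))
  refine ⟨homOfMapFun (fun b => φ (Function.surjInv hq b)) ?_, key⟩
  intro n g x
  have hx : x = q ∘ (Function.surjInv hq ∘ x) := by
    funext i
    exact (Function.surjInv_eq hq (x i)).symm
  conv_lhs => rw [hx, ← q.map_fun, key, φ.map_fun]
  rfl

namespace Congruence

/-- The canonical projection onto the quotient by a congruence. -/
def proj [L.IsAlgebraic] (θ : Congruence L A) : A →[L] Quotient θ.rel :=
  homOfMapFun (fun a => ⟦a⟧) fun g x => (Language.funMap_quotient_mk' θ.rel g x).symm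

theorem proj_surjective [L.IsAlgebraic] (θ : Congruence L A) : Function.Surjective θ.proj :=
  Quotient.mk_surjective

theorem proj_eq_iff [L.IsAlgebraic] {θ : Congruence L A} {a b : A} :
    θ.proj a = θ.proj b ↔ θ.rel.r a b :=
  Quotient.eq

theorem ker_proj [L.IsAlgebraic] (θ : Congruence L A) : ker θ.proj = θ :=
  le_antisymm (fun _ _ => proj_eq_iff.1) fun _ _ => proj_eq_iff.2

theorem gen_le_iff {S : Set (A × A)} {θ : Congruence L A} :
    gen L S ≤ θ ↔ ∀ p ∈ S, θ.rel.r p.1 p.2 :=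
  ⟨fun h p hp => h _ _ fun _ hχ => hχ p hp, fun h _ _ hab => hab θ h⟩

theorem gen_rel_of_mem {S : Set (A × A)} {p : A × A} (hp : p ∈ S) :
    (gen L S).rel.r p.1 p.2 :=
  gen_le_iff.1 le_rfl p hp

theorem gen_mono {S T : Set (A × A)} (h : S ⊆ T) : gen L S ≤ gen L T :=
  gen_le_iff.2 fun _ hp => gen_rel_of_mem (h hp)

/-- Finitely generated congruences are compact. -/
theorem isCompactElement_gen {F : Set (A × A)} (hF : F.Finite) :
    IsCompactElement (gen L F) := by
  intro S χ hne hdir hlub hle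
  have hχ : χ ≤ directedUnion S hne hdir := hlub.2 fun θ hθ a b hab => ⟨θ, hθ, hab⟩
  have hmem : ∀ p : F, ∃ θ : S, θ.1.rel.r p.1.1 p.1.2 := fun p =>
    let ⟨θ, hθ, h⟩ := (gen_le_iff.1 (hle.trans hχ)) p.1 p.2
    ⟨⟨θ, hθ⟩, h⟩
  choose g hg using hmem
  have : Finite F := hF
  have : Nonempty S := hne.to_subtype
  have hd : Directed (· ≤ ·) (fun s : S => (s : Congruence L A)) := hdir.directed_val
  obtain ⟨θ, hθ⟩ := hd.finite_le g
  exact ⟨θ.1, θ.2, gen_le_iff.2 fun p hp => hθ ⟨p, hp⟩ _ _ (hg ⟨p, hp⟩)⟩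

/-- Compact congruences are finitely generated. -/
theorem exists_finite_gen_eq {θ : Congruence L A} (hθ : IsCompactElement θ) :
    ∃ F : Set (A × A), F.Finite ∧ gen L F = θ := by
  classical
  obtain ⟨_, ⟨F, rfl⟩, hF⟩ := hθ
    (Set.range fun F : Finset {p : A × A // θ.rel.r p.1 p.2} =>
      gen L (Subtype.val '' (F : Set {p : A × A // θ.rel.r p.1 p.2}))) θ
    (Set.range_nonempty _)
    (directedOn_range.2 (Monotone.directed_le fun F G h => gen_mono (Set.image_mono h)))
    ⟨by
      rintro _ ⟨F, rfl⟩
      refine gen_le_iff.2 ?_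
      rintro _ ⟨p, _, rfl⟩
      exact p.2,
     fun χ hχ a b hab => hχ ⟨{⟨(a, b), hab⟩}, rfl⟩ a b (gen_rel_of_mem (p := (a, b)) (by simp))⟩
    le_rfl
  refine ⟨_, F.finite_toSet.image _, le_antisymm (gen_le_iff.2 ?_) hF⟩
  rintro _ ⟨p, _, rfl⟩
  exact p.2

end Congruence

end Homomorphisms

/-! ### Terms, equations and membership in a variety -/

section Equations

variable {L : FirstOrder.Language.{u, v}} {X Y A B : Type*} [L.Structure A] [L.Structure B]

@[simp]
theorem Equation.rename_holds {f : X → Y} {e : Equation L X} {a : Y → A} :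
    (e.rename f).Holds a ↔ e.Holds (a ∘ f) := by
  simp [Equation.rename, Equation.Holds]

theorem Equation.Holds.map {e : Equation L X} {a : X → A} (h : e.Holds a) (φ : A →[L] B) :
    e.Holds (φ ∘ a) := by
  simp only [Equation.Holds, Language.HomClass.realize_term] at h ⊢
  rw [h]

theorem Equation.Holds.of_injective {e : Equation L X} {a : X → A} {φ : A →[L] B}
    (hφ : Function.Injective φ) (h : e.Holds (φ ∘ a)) : e.Holds a := by
  simp only [Equation.Holds, Language.HomClass.realize_term] at h ⊢
  exact hφ h

/-- Evaluation of terms under an assignment, as a homomorphism from the term algebra. -/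
def evalHom [L.IsAlgebraic] (a : X → A) : L.Term X →[L] A :=
  homOfMapFun (fun t => t.realize a) fun _ _ => rfl

theorem realize_eq_subst [L.IsAlgebraic] (σ : X → L.Term Y) (t : L.Term X) :
    t.realize σ = t.subst σ := by
  induction t with
  | var => rfl
  | func f ts ih =>
    simp only [Language.Term.realize, Language.Term.subst, ih]
    rfl

theorem realize_var [L.IsAlgebraic] (t : L.Term X) : t.realize Language.Term.var = t := by
  induction t with
  | var => rfl
  | func f ts ih =>
    simp only [Language.Term.realize, ih]
    rfl

namespace Variety

variable {V : Variety L}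

theorem Mem.of_injective (hB : V.Mem B) {φ : A →[L] B} (hφ : Function.Injective φ) : V.Mem A :=
  fun e he a => (hB e he (φ ∘ a)).of_injective hφ

theorem Mem.of_surjective (hA : V.Mem A) {φ : A →[L] B} (hφ : Function.Surjective φ) :
    V.Mem B := by
  intro e he b
  have hb : b = φ ∘ (Function.surjInv hφ ∘ b) := by
    funext i
    exact (Function.surjInv_eq hφ (b i)).symm
  rw [hb]
  exact (hA e he _).map φ

theorem Mem.quotient [L.IsAlgebraic] (hA : V.Mem A) (θ : Congruence L A) :
    V.Mem (Quotient θ.rel) :=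
  hA.of_surjective θ.proj_surjective

/-- The operations of `A × B` are defined componentwise. -/
@[reducible]
def prodStructure [L.IsAlgebraic] (A B : Type*) [L.Structure A] [L.Structure B] :
    L.Structure (A × B) where
  funMap f x := (Language.Structure.funMap f fun i => (x i).1,
    Language.Structure.funMap f fun i => (x i).2)
  RelMap r _ := isEmptyElim r

theorem Mem.prod [L.IsAlgebraic] (hA : V.Mem A) (hB : V.Mem B) :
    @Mem _ V (A × B) (prodStructure A B) := by
  let := prodStructure (L := L) A B
  intro e he a
  let p₁ : A × B →[L] A := homOfMapFun Prod.fst fun _ _ => rfl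
  let p₂ : A × B →[L] B := homOfMapFun Prod.snd fun _ _ => rfl
  have h₁ := hA e he (p₁ ∘ a)
  have h₂ := hB e he (p₂ ∘ a)
  simp only [Equation.Holds, Language.HomClass.realize_term] at h₁ h₂
  exact Prod.ext h₁ h₂

end Variety
end Equations
end UnivAlg

namespace UnivAlg

/-! ### Equational theories and free algebras -/

namespace Variety

variable {L : FirstOrder.Language.{u, v}} {V : Variety L} {X Y : Type*}

theorem Entails.mono {S T : Set (Equation L X)} {e : Equation L X} (hST : S ⊆ T)
    (h : V.Entails S e) : V.Entails T e :=
  fun A _ hA a ha => h A hA a fun s hs => ha s (hST hs)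

theorem entails_of_mem {S : Set (Equation L X)} {e : Equation L X} (he : e ∈ S) :
    V.Entails S e :=
  fun _ _ _ _ ha => ha e he

variable [L.IsAlgebraic]

/-- The congruence of the term algebra consisting of all equations that are `V`-consequences
of `S`. -/
def theory (V : Variety L) (S : Set (Equation L X)) : Congruence L (L.Term X) where
  rel :=
    { r := fun s t => V.Entails S (s, t)
      iseqv :=
        ⟨fun _ _ _ _ _ _ => rfl, fun h A _ hA a ha => (h A hA a ha).symm,
          fun h₁ h₂ A _ hA a ha => (h₁ A hA a ha).trans (h₂ A hA a ha)⟩ }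
  compat f _ _ h A _ hA a ha :=
    congrArg (Language.Structure.funMap f) (funext fun i => h i A hA a ha)

theorem theory_mono {S T : Set (Equation L X)} (hST : S ⊆ T) : V.theory S ≤ V.theory T :=
  fun _ _ h => Entails.mono hST h

/-- An equation holds in a quotient of the term algebra under the canonical assignment if and only
if it belongs to the congruence. -/
theorem holds_proj_var_iff {θ : Congruence L (L.Term X)} {e : Equation L X} :
    e.Holds (fun x => θ.proj (Language.Term.var x)) ↔ θ.rel.r e.1 e.2 := by
  have h : ∀ t : L.Term X, t.realize (fun x => θ.proj (Language.Term.var x)) = θ.proj t :=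
    fun t => (Language.HomClass.realize_term (g := θ.proj) (t := t)).trans
      (by rw [realize_var])
  rw [Equation.Holds, h, h, Congruence.proj_eq_iff]

/-- A quotient of the term algebra belongs to `V` as soon as it identifies the terms that are
identified throughout `V`. -/
theorem mem_quotient_of_theory_le {θ : Congruence L (L.Term X)} (h : V.theory ∅ ≤ θ) :
    V.Mem (Quotient θ.rel) := by
  intro e he a
  obtain ⟨σ, rfl⟩ : ∃ σ : ℕ → L.Term X, a = θ.proj ∘ σ :=
    ⟨fun i => (a i).out, funext fun i => (Quotient.out_eq (a i)).symm⟩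
  simp only [Equation.Holds, Language.HomClass.realize_term, Congruence.proj_eq_iff,
    realize_eq_subst]
  refine h _ _ fun A _ hA b _ => ?_
  simp only [Equation.Holds, Language.Term.realize_subst]
  exact hA e he _

theorem mem_quotient_theory (S : Set (Equation L X)) :
    V.Mem (Quotient (V.theory S).rel) :=
  mem_quotient_of_theory_le (theory_mono (Set.empty_subset S))

theorem holds_theory_proj_var_iff {S : Set (Equation L X)} {e : Equation L X} :
    e.Holds (fun x => (V.theory S).proj (Language.Term.var x)) ↔ V.Entails S e :=
  holds_proj_var_iff

/-- The quotient of the term algebra by `V.theory S` is the algebra of `V` presented by `S`: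
every solution of `S` in an algebra of `V` extends to a homomorphism. -/
theorem exists_hom_of_holds {S : Set (Equation L X)} {A : Type u} [L.Structure A]
    (hA : V.Mem A) (a : X → A) (ha : ∀ e ∈ S, e.Holds a) :
    ∃ φ : Quotient (V.theory S).rel →[L] A, ∀ t : L.Term X, φ ((V.theory S).proj t) =
      t.realize a :=
  exists_hom_comp_eq_of_ker_le (V.theory S).proj (Congruence.proj_surjective _) (evalHom a)
    (by
      rw [Congruence.ker_proj]
      exact fun s t h => h A hA a ha)

theorem freeCongruence_eq (V : Variety L) (X : Type) : V.freeCongruence X = V.theory ∅ := by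
  refine le_antisymm (sInf_le (mem_quotient_theory ∅)) (le_sInf fun θ hθ s t h => ?_)
  exact holds_proj_var_iff (e := (s, t)).1 (h _ hθ _ (by simp))

/-- The canonical map from the term algebra onto the free algebra. -/
def freeProj (V : Variety L) (X : Type) : L.Term X →[L] V.Free X :=
  (V.freeCongruence X).proj

theorem freeProj_surjective (X : Type) : Function.Surjective (V.freeProj X) :=
  Congruence.proj_surjective _

theorem mem_free (X : Type) : V.Mem (V.Free X) :=
  mem_quotient_of_theory_le (freeCongruence_eq V X).ge

/-- The universal property of the free algebra. -/
theorem exists_freeHom {X : Type} {A : Type u} [L.Structure A] (hA : V.Mem A) (a : X → A) :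
    ∃ φ : V.Free X →[L] A, ∀ t : L.Term X, φ (V.freeProj X t) = t.realize a :=
  exists_hom_comp_eq_of_ker_le (V.freeProj X) (freeProj_surjective X) (evalHom a) (by
    rw [freeProj, Congruence.ker_proj, freeCongruence_eq]
    exact fun s t h => h A hA a (by simp))

theorem isFinitelyPresented_free (X : Type) [Finite X] : V.IsFinitelyPresented (V.Free X) := by
  refine ⟨mem_free X, X, ‹_›, Language.Hom.id L _, Function.surjective_id, ?_⟩
  have : Congruence.ker (Language.Hom.id L (V.Free X)) = Congruence.gen L ∅ :=
    le_antisymm (fun a b h => by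
      obtain rfl : a = b := h
      exact Setoid.refl' _ a) (Congruence.gen_le_iff.2 (by simp))
  rw [this]
  exact Congruence.isCompactElement_gen Set.finite_empty

/-- Homomorphisms out of the term algebra are determined by their values on the variables. -/
theorem hom_term_apply {A : Type*} [L.Structure A] (φ : L.Term X →[L] A) (t : L.Term X) :
    φ t = t.realize fun x => φ (Language.Term.var x) := by
  refine Eq.trans ?_ (Language.HomClass.realize_term (g := φ) (t := t)
    (v := Language.Term.var)).symm
  rw [realize_var]

theorem holds_hom_var_iff {A : Type*} [L.Structure A] (φ : L.Term X →[L] A) (e : Equation L X) :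
    e.Holds (fun x => φ (Language.Term.var x)) ↔ φ e.1 = φ e.2 := by
  rw [Equation.Holds, ← hom_term_apply, ← hom_term_apply]

/-- Equational consequence is membership in a congruence of the free algebra. -/
theorem gen_freeProj_rel_iff {X : Type} {P : Set (Equation L X)} {s t : L.Term X} :
    (Congruence.gen L (Prod.map (V.freeProj X) (V.freeProj X) '' P)).rel.r
      (V.freeProj X s) (V.freeProj X t) ↔ V.Entails P (s, t) := by
  constructor
  · intro h A _ hA a ha
    obtain ⟨φ, hφ⟩ := exists_freeHom hA a
    have hle : Congruence.gen L (Prod.map (V.freeProj X) (V.freeProj X) '' P) ≤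
        Congruence.ker φ := by
      refine Congruence.gen_le_iff.2 ?_
      rintro _ ⟨e, he, rfl⟩
      change φ (V.freeProj X e.1) = φ (V.freeProj X e.2)
      rw [hφ, hφ]
      exact ha e he
    have h' : φ (V.freeProj X s) = φ (V.freeProj X t) := hle _ _ h
    rwa [hφ, hφ] at h'
  · intro h
    set θ := Congruence.gen L (Prod.map (V.freeProj X) (V.freeProj X) '' P)
    have := h (Quotient θ.rel) ((mem_free X).quotient θ) _ fun e he =>
      (holds_hom_var_iff (θ.proj.comp (V.freeProj X)) e).2
        (Congruence.proj_eq_iff.2 (Congruence.gen_rel_of_mem (Set.mem_image_of_mem _ he)))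
    exact Congruence.proj_eq_iff.1 ((holds_hom_var_iff (θ.proj.comp (V.freeProj X)) _).1 this)

end Variety
end UnivAlg

namespace UnivAlg

/-! ### From amalgamation and adjoints to uniform deductive interpolation -/

theorem exists_finite_image_prodMap_eq {A B : Type*} {q : A → B} (hq : Function.Surjective q)
    {F : Set (B × B)} (hF : F.Finite) :
    ∃ P : Set (A × A), P.Finite ∧ Prod.map q q '' P = F := by
  refine ⟨Prod.map (Function.surjInv hq) (Function.surjInv hq) '' F, hF.image _, ?_⟩
  rw [← Set.image_comp, Prod.map_comp_map, Function.comp_surjInv, Prod.map_id, Set.image_id]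

namespace Variety

variable {L : FirstOrder.Language.{u, v}} {V : Variety L}

theorem nonempty_of_constants (hconst : Nonempty L.Constants) (A : Type*) [L.Structure A] :
    Nonempty A :=
  hconst.map fun c => Language.Structure.funMap c Fin.elim0

/-- The case of no further variables: the consequences of `S` over `Y` are finitely axiomatized. -/
theorem RightUniformDeductiveInterpolation.exists_finite_entails_iff
    (hV : V.RightUniformDeductiveInterpolation) {X Y : Type} [Finite X] [Finite Y]
    {S : Set (Equation L (X ⊕ Y))} (hS : S.Finite) :
    ∃ P : Set (Equation L Y), P.Finite ∧
      ∀ e : Equation L Y, V.Entails S (e.rename Sum.inr) ↔ V.Entails P e := by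
  obtain ⟨P, hP, hSP, hPS⟩ := hV X Y S hS
  refine ⟨P, hP, fun e => ⟨fun h M _ hM m hm => ?_, fun h M _ hM m hm => ?_⟩⟩
  · have := hPS Empty (e.rename Sum.inl) (fun N _ hN n hn => by
      rw [Equation.rename_holds, Equation.rename_holds]
      have := h N hN (n ∘ Sum.map id Sum.inl) (fun s hs => by
        rw [← Equation.rename_holds]
        exact hn _ (Set.mem_image_of_mem _ hs))
      rw [Equation.rename_holds] at this
      exact this) M hM (Sum.elim m Empty.elim) (by
        rintro _ ⟨e, he, rfl⟩
        rw [Equation.rename_holds]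
        exact hm e he)
    rw [Equation.rename_holds] at this
    exact this
  · rw [Equation.rename_holds]
    exact h M hM _ fun p hp => by
      rw [← Equation.rename_holds]
      exact hSP _ (Set.mem_image_of_mem _ hp) M hM m hm

variable [L.IsAlgebraic]

/-- The interpolant generates `g θ`, where `g` is the right adjoint of the compact lifting of
`F(Y) → F(X ⊕ Y)` and `θ` is the congruence generated by `S`. -/
theorem rightUniformDeductiveInterpolation_of_amalgamation (hconst : Nonempty L.Constants)
    (hamalg : V.AmalgamationProperty) (hadj : V.CompactLiftingsHaveRightAdjoints) :
    V.RightUniformDeductiveInterpolation := by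
  intro X Y _ _ S hS
  obtain ⟨h, hh⟩ := exists_freeHom (mem_free (V := V) (X ⊕ Y))
    fun y : Y => V.freeProj (X ⊕ Y) (Language.Term.var (Sum.inr y))
  have hh' : ∀ t : L.Term Y, h (V.freeProj Y t) = V.freeProj (X ⊕ Y) (t.relabel Sum.inr) := by
    intro t
    rw [hh, hom_term_apply (V.freeProj (X ⊕ Y)) (t.relabel Sum.inr),
      Language.Term.realize_relabel]
    rfl
  obtain ⟨g, hg⟩ := hadj _ _ (isFinitelyPresented_free (V := V) Y)
    (isFinitelyPresented_free (V := V) (X ⊕ Y)) h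
  let θ : KCon L (V.Free (X ⊕ Y)) :=
    ⟨Congruence.gen L (Prod.map (V.freeProj _) (V.freeProj _) '' S),
      Congruence.isCompactElement_gen (hS.image _)⟩
  have hle : ∀ ψ : KCon L (V.Free Y), ψ ≤ g θ ↔ ψ.1 ≤ Congruence.comap h θ.1 := fun ψ =>
    (hg ψ θ).symm.trans (Congruence.gc_map_comap h ψ.1 θ.1)
  obtain ⟨F, hF, hFg⟩ := Congruence.exists_finite_gen_eq (g θ).2
  obtain ⟨P, hP, rfl⟩ := exists_finite_image_prodMap_eq (freeProj_surjective (V := V) Y) hF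
  have key : ∀ e : Equation L Y, V.Entails P e ↔ V.Entails S (e.rename Sum.inr) := by
    intro e
    rw [← Prod.mk.eta (p := e), ← gen_freeProj_rel_iff, hFg]
    refine Iff.trans ?_ (gen_freeProj_rel_iff (s := e.1.relabel Sum.inr))
    rw [← hh', ← hh']
    constructor
    · exact (hle (g θ)).1 le_rfl _ _
    · intro he
      refine (hle ⟨Congruence.gen L {(V.freeProj Y e.1, V.freeProj Y e.2)},
        Congruence.isCompactElement_gen (Set.finite_singleton _)⟩).2
        (Congruence.gen_le_iff.2 ?_) _ _ (Congruence.gen_rel_of_mem (Set.mem_singleton _))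
      rintro _ rfl
      exact he
  refine ⟨P, hP, ?_, fun Z e he => ?_⟩
  · rintro _ ⟨e, he, rfl⟩
    exact (key e).1 (entails_of_mem he)
  · -- The algebras presented by `S` and by `P` over `Y ⊕ Z` are amalgamated over the one
    -- presented by `P` over `Y`.
    set P' : Set (Equation L (Y ⊕ Z)) := Equation.rename Sum.inl '' P
    have hvar : ∀ {W : Type} (T : Set (Equation L W)) (f : Y → W) (t : L.Term Y),
        t.realize (fun y => (V.theory T).proj (Language.Term.var (f y))) =
          (V.theory T).proj (t.relabel f) := by
      intro W T f t
      rw [hom_term_apply (V.theory T).proj (t.relabel f), Language.Term.realize_relabel]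
      rfl
    obtain ⟨i, hi⟩ := exists_hom_of_holds (S := P) (mem_quotient_theory S)
      (fun y => (V.theory S).proj (Language.Term.var (Sum.inr y))) fun e he => by
        rw [Equation.Holds, hvar, hvar, Congruence.proj_eq_iff]
        exact (key e).1 (entails_of_mem he)
    obtain ⟨j, hj⟩ := exists_hom_of_holds (S := P) (mem_quotient_theory P')
      (fun y => (V.theory P').proj (Language.Term.var (Sum.inl y))) fun e he => by
        rw [Equation.Holds, hvar, hvar, Congruence.proj_eq_iff]
        exact entails_of_mem (Set.mem_image_of_mem _ he)
    have hi_inj : Function.Injective i := by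
      intro a b hab
      obtain ⟨s, rfl⟩ := Congruence.proj_surjective _ a
      obtain ⟨t, rfl⟩ := Congruence.proj_surjective _ b
      rw [hi, hi, hvar, hvar, Congruence.proj_eq_iff] at hab
      exact Congruence.proj_eq_iff.2 ((key (s, t)).2 hab)
    have hj_inj : Function.Injective j := by
      intro a b hab
      obtain ⟨s, rfl⟩ := Congruence.proj_surjective _ a
      obtain ⟨t, rfl⟩ := Congruence.proj_surjective _ b
      rw [hj, hj, hvar, hvar, Congruence.proj_eq_iff] at hab
      refine Congruence.proj_eq_iff.2 fun M _ hM m hm => ?_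
      -- The variables in `Z` may be sent to an arbitrary element of `M`.
      obtain ⟨c⟩ := nonempty_of_constants hconst M
      have := hab M hM (Sum.elim m fun _ => c) (by
        rintro _ ⟨e, he, rfl⟩
        rw [Equation.rename_holds]
        exact hm e he)
      exact (Equation.rename_holds (f := Sum.inl) (e := (s, t))).1 this
    obtain ⟨D, _, hD, h, k, hhk⟩ := hamalg _ _ _ (mem_quotient_theory P) (mem_quotient_theory S)
      (mem_quotient_theory P') (Language.Embedding.ofInjective hi_inj)
      (Language.Embedding.ofInjective hj_inj)
    have hhk' : ∀ y, h ((V.theory S).proj (Language.Term.var (Sum.inr y))) =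
        k ((V.theory P').proj (Language.Term.var (Sum.inl y))) := by
      intro y
      have := hhk ((V.theory P).proj (Language.Term.var y))
      simpa [hi, hj] using this
    have hd := he D hD (Sum.elim
        (fun x => h ((V.theory S).proj (Language.Term.var (Sum.inl x))))
        fun y => k ((V.theory P').proj (Language.Term.var y))) (by
      rintro _ ⟨e, he, rfl⟩
      rw [Equation.rename_holds]
      have := (holds_theory_proj_var_iff.2 (entails_of_mem (V := V) he)).map h.toHom
      convert this using 1
      funext z
      rcases z with x | y
      · rfl
      · exact (hhk' y).symm)
    rw [Equation.rename_holds] at hd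
    exact holds_theory_proj_var_iff.1 (Equation.Holds.of_injective (φ := k.toHom) k.injective hd)

/-! ### From uniform deductive interpolation to adjoints -/

/-- Inverse images of compact congruences along homomorphisms between finitely presented algebras are
compact: a deductive interpolant of a presentation of `B / θ` and `h`, in variables for the
generators of `A`, yields generators. -/
theorem RightUniformDeductiveInterpolation.isCompactElement_comap
    (hV : V.RightUniformDeductiveInterpolation) {A B : Type u} [L.Structure A] [L.Structure B]
    (hA : V.IsFinitelyPresented A) (hB : V.IsFinitelyPresented B) (h : A →[L] B)
    {θ : Congruence L B} (hθ : IsCompactElement θ) :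
    IsCompactElement (Congruence.comap h θ) := by
  obtain ⟨hAV, X, _, p, hp, -⟩ := hA
  obtain ⟨hBV, Y, _, q, hq, hker⟩ := hB
  let α : L.Term X →[L] A := p.comp (V.freeProj X)
  let β : L.Term Y →[L] B := q.comp (V.freeProj Y)
  have hα : Function.Surjective α := hp.comp (freeProj_surjective X)
  have hβ : Function.Surjective β := hq.comp (freeProj_surjective Y)
  obtain ⟨F₀, hF₀, hgen₀⟩ := Congruence.exists_finite_gen_eq hker
  obtain ⟨R₀, hR₀, rfl⟩ := exists_finite_image_prodMap_eq (freeProj_surjective (V := V) Y) hF₀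
  obtain ⟨F₁, hF₁, rfl⟩ := Congruence.exists_finite_gen_eq hθ
  obtain ⟨R₁, hR₁, rfl⟩ := exists_finite_image_prodMap_eq hβ hF₁
  set θ := Congruence.gen L (Prod.map β β '' R₁)
  choose t ht using fun x : X => hβ (h (α (Language.Term.var x)))
  -- The defining equations of `B / θ`, together with a description of the images under `h` of the
  -- generators of `A` in terms of the generators of `B`.
  let S : Set (Equation L (Y ⊕ X)) := Equation.rename Sum.inl '' (R₀ ∪ R₁) ∪
    Set.range fun x => ((t x).relabel Sum.inl, Language.Term.var (Sum.inr x))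
  obtain ⟨P, hP, hSP⟩ := hV.exists_finite_entails_iff (S := S)
    (((hR₀.union hR₁).image _).union (Set.finite_range _))
  suffices hcomap : Congruence.comap h θ = Congruence.gen L (Prod.map α α '' P) by
    rw [hcomap]
    exact Congruence.isCompactElement_gen (hP.image _)
  refine le_antisymm (fun a a' haa' => ?_) (Congruence.gen_le_iff.2 ?_)
  · obtain ⟨s, rfl⟩ := hα a
    obtain ⟨s', rfl⟩ := hα a'
    have hS : V.Entails S (Equation.rename Sum.inr (s, s')) := by
      intro M _ hM m hm
      obtain ⟨φ, hφ⟩ := exists_freeHom hM (m ∘ Sum.inl)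
      have hm' : ∀ e ∈ R₀ ∪ R₁, Equation.Holds (m ∘ Sum.inl) e := fun e he => by
        rw [← Equation.rename_holds]
        exact hm _ (Or.inl (Set.mem_image_of_mem _ he))
      obtain ⟨ψ, hψ⟩ := exists_hom_comp_eq_of_ker_le q hq φ (by
        rw [← hgen₀]
        refine Congruence.gen_le_iff.2 ?_
        rintro _ ⟨e, he, rfl⟩
        change φ (V.freeProj Y e.1) = φ (V.freeProj Y e.2)
        rw [hφ, hφ]
        exact hm' e (Or.inl he))
      have hψβ : ∀ r : L.Term Y, ψ (β r) = r.realize (m ∘ Sum.inl) := fun r =>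
        (hψ _).trans (hφ r)
      have hθψ : θ ≤ Congruence.ker ψ := by
        refine Congruence.gen_le_iff.2 ?_
        rintro _ ⟨e, he, rfl⟩
        change ψ (β e.1) = ψ (β e.2)
        rw [hψβ, hψβ]
        exact hm' e (Or.inr he)
      have hm_eq : (m ∘ Sum.inr) = fun x => (ψ.comp (h.comp α)) (Language.Term.var x) := by
        funext x
        have := hm _ (Or.inr ⟨x, rfl⟩)
        rw [Equation.Holds, Language.Term.realize_relabel, ← hψβ, ht] at this
        exact this.symm
      rw [Equation.rename_holds, hm_eq, holds_hom_var_iff]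
      exact hθψ _ _ haa'
    set χ := Congruence.gen L (Prod.map α α '' P)
    have := (hSP _).1 hS (Quotient χ.rel) (hAV.quotient χ) _ fun e he =>
      (holds_hom_var_iff (χ.proj.comp α) e).2
        (Congruence.proj_eq_iff.2 (Congruence.gen_rel_of_mem (Set.mem_image_of_mem _ he)))
    exact Congruence.proj_eq_iff.1 ((holds_hom_var_iff (χ.proj.comp α) _).1 this)
  · rintro _ ⟨e, he, rfl⟩
    have := (hSP e).2 (entails_of_mem he) (Quotient θ.rel) (hBV.quotient θ)
      (Sum.elim (fun y => (θ.proj.comp β) (Language.Term.var y))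
        fun x => (θ.proj.comp (h.comp α)) (Language.Term.var x)) (by
      rintro _ (⟨e, he, rfl⟩ | ⟨x, rfl⟩)
      · rw [Equation.rename_holds]
        refine (holds_hom_var_iff (θ.proj.comp β) e).2 ?_
        rcases he with he | he
        · have hq : q (V.freeProj Y e.1) = q (V.freeProj Y e.2) :=
            hgen₀.le _ _ (Congruence.gen_rel_of_mem (Set.mem_image_of_mem _ he))
          exact congrArg θ.proj hq
        · exact Congruence.proj_eq_iff.2 (Congruence.gen_rel_of_mem (Set.mem_image_of_mem _ he))
      · rw [Equation.Holds, Language.Term.realize_relabel]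
        exact (hom_term_apply (θ.proj.comp β) (t x)).symm.trans (congrArg θ.proj (ht x)))
    rw [Equation.rename_holds] at this
    exact (Congruence.proj_eq_iff (θ := θ)).1
      ((holds_hom_var_iff (θ.proj.comp (h.comp α)) e).1 this)

theorem RightUniformDeductiveInterpolation.compactLiftingsHaveRightAdjoints
    (hV : V.RightUniformDeductiveInterpolation) : V.CompactLiftingsHaveRightAdjoints :=
  fun _ _ _ _ hA hB h =>
    ⟨fun θ => ⟨Congruence.comap h θ.1, hV.isCompactElement_comap hA hB h θ.2⟩,
      fun ψ θ => Congruence.gc_map_comap h ψ.1 θ.1⟩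

end Variety
end UnivAlg

namespace UnivAlg

/-! ### Reduction to finitely many variables -/

section FiniteVariables

variable {L : FirstOrder.Language.{u, v}} {X : Type*}

theorem exists_finite_relabel_eq (t : L.Term X) :
    ∃ F : Set X, F.Finite ∧ ∀ f : X → X, (∀ x ∈ F, f x = x) → t.relabel f = t := by
  induction t with
  | var x => exact ⟨{x}, Set.finite_singleton x, fun f hf => congrArg _ (hf x rfl)⟩
  | func g ts ih =>
    choose F hF hFt using ih
    refine ⟨⋃ i, F i, Set.finite_iUnion hF, fun f hf => ?_⟩
    exact congrArg _ (funext fun i => hFt i f fun x hx => hf x (Set.mem_iUnion_of_mem i hx))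

/-- Finitely many equations and elements of `X` only involve a finite set of variables. Such a set
is a retract of `X`: the map `ρ` collapses the other variables to one of its members, so that
renaming along `ρ` is available for all terms over `X`. -/
theorem exists_finite_retraction [Nonempty X] {S : Set (Equation L X)} (hS : S.Finite)
    {F : Set X} (hF : F.Finite) :
    ∃ (n : ℕ) (ρ : X → Fin n) (φ : Fin n → X), (∀ x ∈ F, φ (ρ x) = x) ∧
      ∀ e ∈ S, e.rename (φ ∘ ρ) = e := by
  choose v hv hvt using exists_finite_relabel_eq (L := L) (X := X)
  obtain ⟨x₀⟩ := ‹Nonempty X›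
  obtain ⟨n, φ, -, hφ⟩ := ((hF.union (hS.biUnion fun e _ => (hv e.1).union (hv e.2))).insert
    x₀).fin_param
  have : Nonempty (Fin n) := by
    obtain ⟨k, -⟩ : x₀ ∈ Set.range φ := hφ ▸ Set.mem_insert _ _
    exact ⟨k⟩
  have hinv : ∀ x ∈ F ∪ ⋃ e ∈ S, v e.1 ∪ v e.2, φ (Function.invFun φ x) = x := fun x hx =>
    Function.invFun_eq (show x ∈ Set.range φ from hφ ▸ Set.mem_insert_of_mem _ hx)
  refine ⟨n, Function.invFun φ, φ, fun x hx => hinv x (Or.inl hx), fun e he => Prod.ext ?_ ?_⟩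
  · exact hvt _ _ fun x hx => hinv x (Or.inr (Set.mem_biUnion he (Or.inl hx)))
  · exact hvt _ _ fun x hx => hinv x (Or.inr (Set.mem_biUnion he (Or.inr hx)))

end FiniteVariables

/-! ### Consequences of Maehara interpolation -/

namespace Variety

variable {L : FirstOrder.Language.{u, v}} {V : Variety L}

/-- A Maehara interpolant `P` of `G` is itself a consequence of `G`, as is seen by interpolating
between `G` and `P` with no further variables. -/
theorem RightUniformMaeharaInterpolation.exists_interpolant
    (hV : V.RightUniformMaeharaInterpolation) {X Y : Type} [Finite X] [Finite Y]
    {G : Set (Equation L (X ⊕ Y))} (hG : G.Finite) :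
    ∃ P : Set (Equation L Y), P.Finite ∧ V.EntailsSet G (Equation.rename Sum.inr '' P) ∧
      ∀ (Z : Type) (S : Set (Equation L (Y ⊕ Z))) (e : Equation L (Y ⊕ Z)), S.Finite →
        V.Entails (Equation.rename (Sum.map id Sum.inl) '' G ∪ Equation.rename Sum.inr '' S :
          Set (Equation L (X ⊕ (Y ⊕ Z)))) (e.rename Sum.inr) →
        V.Entails (Equation.rename Sum.inl '' P ∪ S) e := by
  obtain ⟨P, hP, hPG⟩ := hV X Y G hG
  refine ⟨P, hP, ?_, fun Z S e hS h => ?_⟩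
  · rintro _ ⟨e, he, rfl⟩ M _ hM m hm
    have := (hPG Empty ∅ (Equation.rename Sum.inl '' P) Set.finite_empty (hP.image _)).2
      (fun e he => entails_of_mem (Or.inl he)) _
      (Set.mem_image_of_mem _ (Set.mem_image_of_mem _ he)) M hM
      (Sum.elim (m ∘ Sum.inl) (Sum.elim (m ∘ Sum.inr) Empty.elim)) (by
        rintro _ (⟨s, hs, rfl⟩ | ⟨s, hs, rfl⟩)
        · rw [Equation.rename_holds]
          convert hm s hs using 1
          funext z
          rcases z with x | y <;> rfl
        · exact hs.elim)
    rw [Equation.rename_holds, Equation.rename_holds] at this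
    rw [Equation.rename_holds]
    exact this
  · exact (hPG Z S {e} hS (Set.finite_singleton e)).1
      (by rintro _ ⟨_, rfl, rfl⟩; exact h) e rfl

/-- The finite form of transferability of injections: finitely many facts about `B` and `C`,
together with finitely many of the identifications `i a ≈ f a`, do not identify distinct elements
of `C`. The interpolant is over variables for elements of `A`; it holds in `B`, hence in `A` since
`i` is injective, hence in `C`. -/
theorem RightUniformMaeharaInterpolation.eq_of_entails (hconst : Nonempty L.Constants)
    (hV : V.RightUniformMaeharaInterpolation) {A B C : Type u} [L.Structure A] [L.Structure B]
    [L.Structure C] (hB : V.Mem B) (hC : V.Mem C) (i : A →[L] B)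
    (hi : Function.Injective i) (f : A →[L] C) {G : Set (Equation L B)} (hG : G.Finite)
    (hGB : ∀ e ∈ G, e.Holds id) {S : Set (Equation L C)} (hS : S.Finite)
    (hSC : ∀ e ∈ S, e.Holds id) {E : Set A} (hE : E.Finite) {c c' : C}
    (h : V.Entails (Equation.rename Sum.inl '' G ∪ Equation.rename Sum.inr '' S ∪
      (fun a => (Language.Term.var (Sum.inl (i a)), Language.Term.var (Sum.inr (f a)))) '' E :
        Set (Equation L (B ⊕ C)))
      (Language.Term.var (Sum.inr c), Language.Term.var (Sum.inr c'))) : c = c' := by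
  have := nonempty_of_constants hconst A
  have := nonempty_of_constants hconst B
  have := nonempty_of_constants hconst C
  obtain ⟨nA, ρA, φA, hA, -⟩ := exists_finite_retraction (L := L) (S := ∅) Set.finite_empty hE
  obtain ⟨nB, ρB, φB, hBE, hBG⟩ := exists_finite_retraction hG (hE.image i)
  obtain ⟨nC, ρC, φC, hCE, hCS⟩ := exists_finite_retraction hS
    ((hE.image f).union (Set.toFinite {c, c'}))
  let G' : Set (Equation L (Fin nB ⊕ Fin nA)) := Equation.rename (Sum.inl ∘ ρB) '' G ∪
    (fun a => (Language.Term.var (Sum.inl (ρB (i a))), Language.Term.var (Sum.inr (ρA a)))) '' E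
  let S' : Set (Equation L (Fin nA ⊕ Fin nC)) := Equation.rename (Sum.inr ∘ ρC) '' S ∪
    (fun a => (Language.Term.var (Sum.inl (ρA a)), Language.Term.var (Sum.inr (ρC (f a))))) '' E
  obtain ⟨P, -, hGP, hPS⟩ := hV.exists_interpolant (G := G') ((hG.image _).union (hE.image _))
  have hP : ∀ e ∈ P, e.Holds φA := fun e he => by
    have := hGP _ (Set.mem_image_of_mem _ he) B hB (Sum.elim φB (i ∘ φA)) (by
      rintro _ (⟨e, he, rfl⟩ | ⟨a, ha, rfl⟩)
      · have := hGB e he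
        rw [← hBG e he] at this
        rw [Equation.rename_holds] at this ⊢
        exact this
      · exact (hBE _ (Set.mem_image_of_mem _ ha)).trans (congrArg i (hA a ha)).symm)
    rw [Equation.rename_holds] at this
    exact Equation.Holds.of_injective hi this
  have hcc' := hPS (Fin nC) S'
    (Language.Term.var (Sum.inr (ρC c)), Language.Term.var (Sum.inr (ρC c')))
    ((hS.image _).union (hE.image _)) (fun M _ hM m hm =>
      h M hM (Sum.elim (m ∘ Sum.inl ∘ ρB) (m ∘ Sum.inr ∘ Sum.inr ∘ ρC)) (by
        rintro _ ((⟨e, he, rfl⟩ | ⟨e, he, rfl⟩) | ⟨a, ha, rfl⟩)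
        · have := hm _ (Or.inl (Set.mem_image_of_mem _ (Or.inl (Set.mem_image_of_mem _ he))))
          rw [Equation.rename_holds, Equation.rename_holds] at this
          rw [Equation.rename_holds]
          exact this
        · have := hm _ (Or.inr (Set.mem_image_of_mem _ (Or.inl (Set.mem_image_of_mem _ he))))
          rw [Equation.rename_holds, Equation.rename_holds] at this
          rw [Equation.rename_holds]
          exact this
        · have h₁ := hm _ (Or.inl (Set.mem_image_of_mem _ (Or.inr (Set.mem_image_of_mem _ ha))))
          have h₂ := hm _ (Or.inr (Set.mem_image_of_mem _ (Or.inr (Set.mem_image_of_mem _ ha))))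
          exact Eq.trans h₁ h₂))
    C hC (Sum.elim (f ∘ φA) φC) (by
      rintro _ (⟨e, he, rfl⟩ | ⟨e, he, rfl⟩ | ⟨a, ha, rfl⟩)
      · rw [Equation.rename_holds]
        exact (hP e he).map f
      · have := hSC e he
        rw [← hCS e he] at this
        rw [Equation.rename_holds] at this ⊢
        exact this
      · exact (congrArg f (hA a ha)).trans
          (hCE _ (Or.inl (Set.mem_image_of_mem _ ha))).symm)
  exact (hCE c (by simp)).symm.trans (Eq.trans hcc' (hCE c' (by simp)))

theorem RightUniformMaeharaInterpolation.rightUniformDeductiveInterpolation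
    (hV : V.RightUniformMaeharaInterpolation) : V.RightUniformDeductiveInterpolation := by
  intro X Y _ _ S hS
  obtain ⟨P, hP, hSP, hPS⟩ := hV.exists_interpolant hS
  refine ⟨P, hP, hSP, fun Z e he => ?_⟩
  have := hPS Z ∅ e Set.finite_empty (he.mono Set.subset_union_left)
  rwa [Set.union_empty] at this

variable [L.IsAlgebraic]

/-- Injections are transferable: an injective homomorphism `i : A → B` can be pushed along any
homomorphism `f : A → C`. The algebra `D` is the pushout of `i` and `f`, presented by the
equational diagrams of `B` and `C` and the identifications `i a ≈ f a`; it is built as the union of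
the theories of the finite parts of this presentation. -/
theorem RightUniformMaeharaInterpolation.exists_transfer (hconst : Nonempty L.Constants)
    (hV : V.RightUniformMaeharaInterpolation) {A B C : Type u} [L.Structure A] [L.Structure B]
    [L.Structure C] (hB : V.Mem B) (hC : V.Mem C) (i : A →[L] B)
    (hi : Function.Injective i) (f : A →[L] C) :
    ∃ (D : Type u) (_ : L.Structure D), V.Mem D ∧ ∃ (h : B →[L] D) (k : C →[L] D),
      Function.Injective k ∧ ∀ a, h (i a) = k (f a) := by
  classical
  let S : Finset {e : Equation L B // e.Holds id} × Finset {e : Equation L C // e.Holds id} ×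
      Finset A → Set (Equation L (B ⊕ C)) := fun T =>
    Equation.rename Sum.inl '' (Subtype.val '' (T.1 : Set {e : Equation L B // e.Holds id})) ∪
      Equation.rename Sum.inr '' (Subtype.val '' (T.2.1 : Set {e : Equation L C // e.Holds id})) ∪
      (fun a => (Language.Term.var (Sum.inl (i a)), Language.Term.var (Sum.inr (f a)))) ''
        (T.2.2 : Set A)
  have hS : Monotone S := fun T T' hT => Set.union_subset_union
    (Set.union_subset_union (Set.image_mono (Set.image_mono hT.1))
      (Set.image_mono (Set.image_mono hT.2.1))) (Set.image_mono hT.2.2)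
  let Θ : Congruence L (L.Term (B ⊕ C)) :=
    Congruence.directedUnion (Set.range fun T => V.theory (S T)) (Set.range_nonempty _)
      (directedOn_range.2 (Monotone.directed_le fun _ _ hT => theory_mono (hS hT)))
  have hΘ : ∀ T, ∀ e ∈ S T, Θ.proj e.1 = Θ.proj e.2 := fun T e he =>
    Congruence.proj_eq_iff.2 ⟨_, ⟨T, rfl⟩, entails_of_mem he⟩
  refine ⟨Quotient Θ.rel, inferInstance, mem_quotient_of_theory_le fun s t hst =>
    ⟨_, ⟨(∅, ∅, ∅), rfl⟩, theory_mono (Set.empty_subset _) _ _ hst⟩,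
    homOfMapFun (fun b => Θ.proj (Language.Term.var (Sum.inl b))) fun g x => ?_,
    homOfMapFun (fun c => Θ.proj (Language.Term.var (Sum.inr c))) fun g x => ?_, ?_, fun a => ?_⟩
  -- Both maps are homomorphisms: the diagrams contain the equations evaluating each operation.
  · refine Eq.trans ?_ (Θ.proj.map_fun g (Language.Term.var ∘ Sum.inl ∘ x))
    exact hΘ ({⟨(Language.Term.var (Language.Structure.funMap g x),
      Language.Term.func g fun j => Language.Term.var (x j)), rfl⟩}, ∅, ∅) _
      (Or.inl (Or.inl ⟨_, ⟨_, Finset.mem_coe.2 (Finset.mem_singleton_self _), rfl⟩, rfl⟩))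
  · refine Eq.trans ?_ (Θ.proj.map_fun g (Language.Term.var ∘ Sum.inr ∘ x))
    exact hΘ (∅, {⟨(Language.Term.var (Language.Structure.funMap g x),
      Language.Term.func g fun j => Language.Term.var (x j)), rfl⟩}, ∅) _
      (Or.inl (Or.inr ⟨_, ⟨_, Finset.mem_coe.2 (Finset.mem_singleton_self _), rfl⟩, rfl⟩))
  · intro c c' hcc'
    obtain ⟨_, ⟨T, rfl⟩, hT⟩ := Congruence.proj_eq_iff.1 hcc'
    refine hV.eq_of_entails hconst hB hC i hi f (T.1.finite_toSet.image _) ?_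
      (T.2.1.finite_toSet.image _) ?_ T.2.2.finite_toSet hT
    · rintro _ ⟨e, -, rfl⟩
      exact e.2
    · rintro _ ⟨e, -, rfl⟩
      exact e.2
  · exact hΘ (∅, ∅, {a}) _ (Or.inr ⟨a, by simp, rfl⟩)

theorem RightUniformMaeharaInterpolation.amalgamationProperty (hconst : Nonempty L.Constants)
    (hV : V.RightUniformMaeharaInterpolation) : V.AmalgamationProperty := by
  intro A B C _ _ _ _ hB hC i j
  -- The two transfers are combined in the product of their targets.
  obtain ⟨D₁, _, hD₁, h₁, k₁, hk₁, hc₁⟩ :=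
    hV.exists_transfer hconst hB hC i.toHom i.injective j.toHom
  obtain ⟨D₂, _, hD₂, k₂, h₂, hh₂, hc₂⟩ :=
    hV.exists_transfer hconst hC hB j.toHom j.injective i.toHom
  let := prodStructure (L := L) D₁ D₂
  let h : B →[L] D₁ × D₂ := homOfMapFun (fun b => (h₁ b, h₂ b)) fun g x =>
    Prod.ext (h₁.map_fun g x) (h₂.map_fun g x)
  let k : C →[L] D₁ × D₂ := homOfMapFun (fun c => (k₁ c, k₂ c)) fun g x =>
    Prod.ext (k₁.map_fun g x) (k₂.map_fun g x)
  have hh : Function.Injective h := fun b b' hb => hh₂ (congrArg Prod.snd hb)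
  have hk : Function.Injective k := fun c c' hc => hk₁ (congrArg Prod.fst hc)
  exact ⟨D₁ × D₂, inferInstance, hD₁.prod hD₂, Language.Embedding.ofInjective hh,
    Language.Embedding.ofInjective hk, fun a => Prod.ext (hc₁ a) (hc₂ a).symm⟩

theorem RightUniformMaeharaInterpolation.congruenceExtensionProperty
    (hconst : Nonempty L.Constants) (hV : V.RightUniformMaeharaInterpolation) :
    V.CongruenceExtensionProperty := by
  intro A _ hA S θ
  have hS : V.Mem S := hA.of_injective (φ := S.subtype.toHom) S.subtype.injective
  obtain ⟨D, _, -, h, k, hk, hhk⟩ := hV.exists_transfer hconst hA (hS.quotient θ)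
    S.subtype.toHom S.subtype.injective θ.proj
  refine ⟨Congruence.ker h, fun a b => Iff.trans ?_ (Congruence.proj_eq_iff (θ := θ))⟩
  rw [← hk.eq_iff, ← hhk, ← hhk]
  rfl

/-! ### From deductive to Maehara interpolation -/

/-- Let `α` be a homomorphism from a term algebra whose kernel consists of consequences of `P`. If
every congruence of the target that identifies the images under `α` of both sides of the equations
in `S` also does so for `e`, then `e` is a consequence of `P` and `S`: by congruence extension, the
congruence that `S` generates on the image of `α` is the restriction of one on the target. -/
theorem CongruenceExtensionProperty.entails_union (hV : V.CongruenceExtensionProperty)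
    {W : Type} {A : Type u} [L.Structure A] (hA : V.Mem A) (α : L.Term W →[L] A)
    {P S : Set (Equation L W)} (hP : Congruence.ker α ≤ V.theory P) {e : Equation L W}
    (he : ∀ ψ : Congruence L A, (∀ s ∈ S, ψ.rel.r (α s.1) (α s.2)) → ψ.rel.r (α e.1) (α e.2)) :
    V.Entails (P ∪ S) e := by
  intro M _ hM m hm
  let q : L.Term W →[L] α.range := α.codRestrict α.range fun t => ⟨t, rfl⟩
  have hq : Function.Surjective q := by
    rintro ⟨_, t, rfl⟩
    exact ⟨t, rfl⟩
  obtain ⟨φ, hφ⟩ := exists_hom_comp_eq_of_ker_le q hq (evalHom m) fun s t hst =>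
    hP s t (congrArg Subtype.val hst) M hM m fun p hp => hm p (Or.inl hp)
  set θ := Congruence.gen L (Prod.map q q '' S)
  have hθ : θ ≤ Congruence.ker φ := by
    refine Congruence.gen_le_iff.2 ?_
    rintro _ ⟨s, hs, rfl⟩
    exact (hφ s.1).trans (Eq.trans (hm s (Or.inr hs)) (hφ s.2).symm)
  obtain ⟨ψ, hψ⟩ := hV A hA α.range θ
  have := hθ _ _ ((hψ (q e.1) (q e.2)).1 (he ψ fun s hs =>
    (hψ (q s.1) (q s.2)).2 (Congruence.gen_rel_of_mem (Set.mem_image_of_mem _ hs))))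
  exact (hφ e.1).symm.trans (Eq.trans this (hφ e.2))

theorem rightUniformMaeharaInterpolation_of_congruenceExtension
    (hV : V.RightUniformDeductiveInterpolation) (hcep : V.CongruenceExtensionProperty) :
    V.RightUniformMaeharaInterpolation := by
  intro X Y _ _ G hG
  obtain ⟨P, hP, hGP, hPG⟩ := hV X Y G hG
  refine ⟨P, hP, fun Z S D _ _ => ⟨fun h e he => ?_, fun h => ?_⟩⟩
  · set G' : Set (Equation L (X ⊕ (Y ⊕ Z))) := Equation.rename (Sum.map id Sum.inl) '' G
    let α : L.Term (Y ⊕ Z) →[L] Quotient (V.theory G').rel :=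
      evalHom fun w => (V.theory G').proj (Language.Term.var (Sum.inr w))
    have hα : ∀ t, α t = (V.theory G').proj (t.relabel Sum.inr) := fun t => by
      rw [hom_term_apply (V.theory G').proj (t.relabel Sum.inr), Language.Term.realize_relabel]
      rfl
    refine hcep.entails_union (mem_quotient_theory G') α (fun s t hst => ?_) fun ψ hψ => ?_
    · refine hPG Z (s, t) ((Congruence.proj_eq_iff (θ := V.theory G')).1 ?_)
      exact (hα s).symm.trans (Eq.trans hst (hα t))
    · have := h _ (Set.mem_image_of_mem _ he) (Quotient ψ.rel)
        ((mem_quotient_theory G').quotient ψ)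
        (fun x => (ψ.proj.comp (V.theory G').proj) (Language.Term.var x)) (by
        rintro g (hg | ⟨s, hs, rfl⟩)
        · exact (holds_theory_proj_var_iff.2 (entails_of_mem hg)).map ψ.proj
        · refine (holds_hom_var_iff (ψ.proj.comp (V.theory G').proj) _).2 ?_
          have := Congruence.proj_eq_iff.2 (hψ s hs)
          rwa [hα, hα] at this)
      have := (holds_hom_var_iff (ψ.proj.comp (V.theory G').proj) _).1 this
      rw [hα, hα]
      exact Congruence.proj_eq_iff.1 this
  · rintro _ ⟨e, he, rfl⟩ M _ hM m hm
    rw [Equation.rename_holds]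
    refine h e he M hM _ ?_
    rintro _ (⟨p, hp, rfl⟩ | hs)
    · rw [Equation.rename_holds]
      have := hGP _ (Set.mem_image_of_mem _ hp) M hM (m ∘ Sum.map id Sum.inl) fun g hg => by
        rw [← Equation.rename_holds]
        exact hm _ (Or.inl (Set.mem_image_of_mem _ hg))
      rw [Equation.rename_holds] at this
      exact this
    · rw [← Equation.rename_holds]
      exact hm _ (Or.inr (Set.mem_image_of_mem _ hs))

end Variety
end UnivAlg

theorem theorem3p12 {L : FirstOrder.Language.{u, v}} [L.IsAlgebraic]
    (hconst : Nonempty L.Constants) (V : UnivAlg.Variety L) :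
    List.TFAE
      [V.RightUniformMaeharaInterpolation,
       V.RightUniformDeductiveInterpolation ∧ V.CongruenceExtensionProperty,
       V.AmalgamationProperty ∧ V.CongruenceExtensionProperty ∧
         V.CompactLiftingsHaveRightAdjoints] := by
  tfae_have 1 → 2 := fun h =>
    ⟨h.rightUniformDeductiveInterpolation, h.congruenceExtensionProperty hconst⟩
  tfae_have 2 → 1 := fun h =>
    UnivAlg.Variety.rightUniformMaeharaInterpolation_of_congruenceExtension h.1 h.2
  tfae_have 1 → 3 := fun h =>
    ⟨h.amalgamationProperty hconst, h.congruenceExtensionProperty hconst,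
      h.rightUniformDeductiveInterpolation.compactLiftingsHaveRightAdjoints⟩
  tfae_have 3 → 2 := fun h =>
    ⟨UnivAlg.Variety.rightUniformDeductiveInterpolation_of_amalgamation hconst h.1 h.2.2, h.2.1⟩
  tfae_finish
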